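/- There is an absolute constant $\gamma>0$ such that for every integer $c\ge 0$ there is an integer $a_0$ (depending only on $c$) with the following property, for every integer $a\ge a_0$. Let $n,k,s\ge 0$ be integers, let $K>2$ be real, and let $\|\cdot\|$ be a norm on $\mathbb R^n$ with $n^{-c}\|x\|_2\le\|x\|\le n^{c}\|x\|_2$ for all $x\in\mathbb R^n$. Consider a randomized streaming algorithm with $s$ bits of memory which maintains a vector $x\in\mathbb R^n$, initially $0$, under turnstile updates $x_i:=x_i+\delta$ with $\delta\in\mathbb Z$. (Between two updates the algorithm stores exactly $s$ bits. Its new memory contents are an arbitrary function of the old contents, the update, the number of updates so far, and random bits, access to which is free of charge; its output is an arbitrary function of the final memory contents, the number of updates and the random bits. Deterministic algorithms are a special case.) Suppose that for each stream of updates for which all entries of $x$ are integers between $0$ and $n^{a}$ at every moment of time, the algorithm outputs at the end, except with probability at most $1/4$, a vector $y\in\mathbb R^n$ such that $$\|x-y\|\le K\cdot\min_{k\text{-sparse }x^*\in\mathbb R^n}\|x-x^*\|.$$ Then $$s\ \ge\ \gamma\, d\cdot\frac{\log n}{\log K},$$ where $d$ is the doubling dimension of the set of non-negative $k$-sparse vectors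 of $\mathbb R^n$ with the metric $\|x-y\|$, that is, $d=\log_2\lambda$ for the least integer $\lambda$ such that every ball of this metric space can be covered by $\lambda$ balls of half its radius (with centers in the space). (For $n=0$ the right-hand side is read as $0$.) -/

import Mathlib

/-- A vector is `k`-sparse if it has at most `k` non-zero coordinates. -/
def IsSparse {n : ℕ} (k : ℕ) (x : EuclideanSpace ℝ (Fin n)) : Prop :=
  {i | x i ≠ 0}.ncard ≤ k

/-- The set of `k`-sparse vectors all of whose coordinates are non-negative. -/
def nonnegSparse (n k : ℕ) : Set (EuclideanSpace ℝ (Fin n)) :=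
  {x | IsSparse k x ∧ ∀ i, 0 ≤ x i}

/-- `n^{-c} ≤ N x / ‖x‖₂ ≤ n^c` for all non-zero `x`. The first inequality makes the seminorm `N`
a norm. -/
def HasPolyAspectRatio {n : ℕ} (c : ℕ) (N : Seminorm ℝ (EuclideanSpace ℝ (Fin n))) : Prop :=
  ∀ x, ‖x‖ ≤ (n : ℝ) ^ c * N x ∧ N x ≤ (n : ℝ) ^ c * ‖x‖

/-- In the metric space `S`, with the distance `N (x - y)`, every ball can be covered by at most
`m` balls of half the radius. -/
def CoversByHalfBalls {E : Type*} [AddCommGroup E] [Module ℝ E] (N : Seminorm ℝ E) (S : Set E)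
    (m : ℕ) : Prop :=
  ∀ p ∈ S, ∀ r : ℝ, 0 < r → ∃ T : Finset E, (T : Set E) ⊆ S ∧ T.card ≤ m ∧
    ∀ y ∈ S, N (y - p) ≤ r → ∃ q ∈ T, N (y - q) ≤ r / 2

/-- The doubling constant of `S` under `N`: the least number of balls that suffices. -/
noncomputable def doublingConstant {E : Type*} [AddCommGroup E] [Module ℝ E] (N : Seminorm ℝ E)
    (S : Set E) : ℕ :=
  sInf {m : ℕ | CoversByHalfBalls N S m}

/-- The doubling dimension: the binary logarithm of the doubling constant. -/
noncomputable def doublingDimension {E : Type*} [AddCommGroup E] [Module ℝ E] (N : Seminorm ℝ E)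
    (S : Set E) : ℝ :=
  Real.logb 2 (doublingConstant N S)

/-- Under the norms considered here the doubling constant of any set is finite, so that the
infimum in `doublingConstant` is a minimum. -/
theorem exists_coversByHalfBalls {n c : ℕ} {N : Seminorm ℝ (EuclideanSpace ℝ (Fin n))}
    (hN : HasPolyAspectRatio c N) (S : Set (EuclideanSpace ℝ (Fin n))) :
    ∃ m, CoversByHalfBalls N S m := by
  classical
  set A : ℝ := (n : ℝ) ^ c with hA
  have hA0 : 0 ≤ A := by positivity
  set δ : ℝ := 1 / (4 * (A + 1)) with hδ
  have hδ0 : 0 < δ := by positivity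
  obtain ⟨F, hF, hcov⟩ := Metric.totallyBounded_iff.1
    (isCompact_closedBall (0 : EuclideanSpace ℝ (Fin n)) A).totallyBounded δ hδ0
  refine ⟨hF.toFinset.card, fun p hp r hr => ?_⟩
  let g : EuclideanSpace ℝ (Fin n) → EuclideanSpace ℝ (Fin n) := fun f =>
    if h : ∃ y ∈ S, ‖r⁻¹ • (y - p) - f‖ < δ then h.choose else p
  have hg : ∀ f, g f ∈ S := by
    intro f
    by_cases h : ∃ y ∈ S, ‖r⁻¹ • (y - p) - f‖ < δ
    · simp only [g, dif_pos h]
      exact h.choose_spec.1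
    · simpa only [g, dif_neg h] using hp
  refine ⟨hF.toFinset.image g, ?_, Finset.card_image_le, fun y hy hyr => ?_⟩
  · intro q hq
    obtain ⟨f, -, rfl⟩ := Finset.mem_image.1 (Finset.mem_coe.1 hq)
    exact hg f
  · have h1 : N (r⁻¹ • (y - p)) ≤ 1 := by
      rw [map_smul_eq_mul, Real.norm_of_nonneg (by positivity), inv_mul_le_iff₀ hr]
      simpa using hyr
    have h2 : ‖r⁻¹ • (y - p)‖ ≤ A := by
      have := (hN (r⁻¹ • (y - p))).1
      nlinarith
    obtain ⟨f, hf, hfd⟩ := Set.mem_iUnion₂.1 (hcov (mem_closedBall_zero_iff.2 h2))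
    rw [Metric.mem_ball, dist_eq_norm] at hfd
    have h : ∃ y ∈ S, ‖r⁻¹ • (y - p) - f‖ < δ := ⟨y, hy, hfd⟩
    refine ⟨g f, Finset.mem_image_of_mem g (hF.mem_toFinset.2 hf), ?_⟩
    have h3 : ‖r⁻¹ • (g f - p) - f‖ < δ := by
      simp only [g, dif_pos h]
      exact h.choose_spec.2
    have h4 : y - g f = r • ((r⁻¹ • (y - p) - f) - (r⁻¹ • (g f - p) - f)) := by
      rw [sub_sub_sub_cancel_right, ← smul_sub, smul_smul, mul_inv_cancel₀ hr.ne', one_smul]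
      abel
    have h5 := norm_sub_le (r⁻¹ • (y - p) - f) (r⁻¹ • (g f - p) - f)
    have h6 := (hN ((r⁻¹ • (y - p) - f) - (r⁻¹ • (g f - p) - f))).2
    rw [h4, map_smul_eq_mul, Real.norm_of_nonneg hr.le]
    have h7 : A * (2 * δ) ≤ 1 / 2 := by
      rw [hδ, show A * (2 * (1 / (4 * (A + 1)))) = (A / (A + 1)) / 2 by field_simp; norm_num]
      have : A / (A + 1) ≤ 1 := (div_le_one (by positivity)).2 (by linarith)
      linarith
    have h8 : N ((r⁻¹ • (y - p) - f) - (r⁻¹ • (g f - p) - f)) ≤ 1 / 2 :=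
      h6.trans ((mul_le_mul_of_nonneg_left (by linarith) hA0).trans h7)
    nlinarith

/-- A turnstile update `(i, δ)`, that is, `x i := x i + δ`. -/
abbrev TurnstileUpdate (n : ℕ) : Type := Fin n × ℤ

/-- The vector that a stream of updates leads to, starting from the zero vector. -/
def streamVector {n : ℕ} (l : List (TurnstileUpdate n)) : Fin n → ℤ :=
  (l.map fun u => (Pi.single u.1 u.2 : Fin n → ℤ)).sum

/-- The same vector, as a vector of `ℝⁿ`. -/
noncomputable def realStreamVector {n : ℕ} (l : List (TurnstileUpdate n)) :
    EuclideanSpace ℝ (Fin n) :=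
  WithLp.toLp 2 fun i => (streamVector l i : ℝ)

/-- The promise on the stream: at any moment of time all entries lie in `{0, …, M}`. -/
def IsPromisedStream {n : ℕ} (M : ℤ) (l : List (TurnstileUpdate n)) : Prop :=
  ∀ l', l' <+: l → ∀ i, 0 ≤ streamVector l' i ∧ streamVector l' i ≤ M

/-- A randomized streaming algorithm for vectors of length `n` whose memory between two updates
consists of `s` bits. `Ω` is the sample space of its random bits. Reading the random bits and the
number of updates made so far is free of charge and there is no restriction on computing time;
in particular an algorithm that tosses fresh coins at each step is of this form, and so is
a deterministic algorithm (`Ω` a point). -/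
structure StreamingAlgorithm (n s : ℕ) (Ω : Type*) where
  /-- the initial memory contents -/
  init : Ω → (Fin s → Bool)
  /-- the new memory contents, given the number of earlier updates, the old contents
  and the update -/
  update : Ω → ℕ → (Fin s → Bool) → TurnstileUpdate n → (Fin s → Bool)
  /-- the output, given the number of updates and the final memory contents -/
  output : Ω → ℕ → (Fin s → Bool) → EuclideanSpace ℝ (Fin n)

namespace StreamingAlgorithm

variable {n s : ℕ} {Ω : Type*}

/-- The memory contents after a stream, if `t` updates were made before and the contents
were `m`. -/
def runFrom (alg : StreamingAlgorithm n s Ω) (ω : Ω) :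
    ℕ → (Fin s → Bool) → List (TurnstileUpdate n) → (Fin s → Bool)
  | _, m, [] => m
  | t, m, u :: l => alg.runFrom ω (t + 1) (alg.update ω t m u) l

/-- The output of the algorithm at the end of a stream. -/
def result (alg : StreamingAlgorithm n s Ω) (ω : Ω) (l : List (TurnstileUpdate n)) :
    EuclideanSpace ℝ (Fin n) :=
  alg.output ω l.length (alg.runFrom ω 0 (alg.init ω) l)

end StreamingAlgorithm

/-- `y` approximates `x` under `N` up to the factor `K` as well as the best `k`-sparse vector:
`N (x - y) ≤ K * min_{z k-sparse} N (x - z)`. -/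
def IsApproxSparse {n : ℕ} (N : Seminorm ℝ (EuclideanSpace ℝ (Fin n))) (k : ℕ) (K : ℝ)
    (x y : EuclideanSpace ℝ (Fin n)) : Prop :=
  ∀ z, IsSparse k z → N (x - y) ≤ K * N (x - z)

/-- On each stream whose entries stay in `{0, …, M}` at all times, the probability that the output
is not a `K`-approximate best `k`-sparse approximation is at most `1 / 4`. -/
def StreamingAlgorithm.Solves {n s : ℕ} {Ω : Type*} [MeasurableSpace Ω]
    (alg : StreamingAlgorithm n s Ω) (μ : MeasureTheory.Measure Ω)
    (N : Seminorm ℝ (EuclideanSpace ℝ (Fin n))) (k : ℕ) (K : ℝ) (M : ℤ) : Prop :=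
  ∀ l : List (TurnstileUpdate n), IsPromisedStream M l →
    μ {ω | ¬ IsApproxSparse N k K (realStreamVector l) (alg.result ω l)} ≤ 1 / 4

/-! The bound is a reduction from augmented indexing. If λ is the doubling constant, some ball
contains λ points at pairwise distance more than half its radius; scaling and rounding turn them
into integer code words y(a) (`exists_integer_code`). A word J is encoded as ∑ D^u y(J_u), with D
polynomial in K, and the message is the memory after this vector has been streamed in. Whoever knows
the letters after position t can subtract their terms. The rest is close to the k-sparse vector S_t
y(J_t), where S_t = ∑_{u ≤ t} D^u, because the earlier weights are geometrically smaller; so a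
successful output reveals J_t. Entries polynomial in n leave room for about log n / log K positions,
each worth a constant fraction of log λ.

Comparing with S_t y(J_t) and not D^t y(J_t) matters: the ball may lie far from 0, so only
differences of code words are small under N.

The communication bound `mul_log_card_le_of_predictors` uses weights in place of entropy: each
message defines a probability distribution on words, and all of them together have mass equal to the
number of messages. -/

/-! ### Augmented indexing -/

/-- If `w a` is a weight of total mass `1` for every predicted symbol `a`, then predicting each
letter of a word from the later letters gives a weight of total mass `1` on words. -/
theorem sum_prod_predictor {A : Type*} [Fintype A] [Nonempty A] (w : A → A → ℝ)
    (hw : ∀ a, ∑ b, w a b = 1) {T : ℕ} (g : Fin T → (Fin T → A) → A)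
    (hg : ∀ t J J', (∀ u, t < u → J u = J' u) → g t J = g t J') :
    ∑ J : Fin T → A, ∏ t, w (g t J) (J t) = 1 := by
  induction T with
  | zero => simp
  | succ T ih =>
    obtain ⟨a₀⟩ := ‹Nonempty A›
    -- No predictor looks at letter 0, since each sees only letters strictly after its own position.
    -- Summing over letter 0 first gives a factor 1 and leaves the claim for the tail.
    rw [← (Fin.consEquiv fun _ : Fin (T + 1) => A).sum_comp, Fintype.sum_prod_type_right]
    have h0 : ∀ a (J : Fin T → A), g 0 (Fin.cons a J : Fin (T + 1) → A) =
        g 0 (Fin.cons a₀ J : Fin (T + 1) → A) := by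
      refine fun a J => hg _ _ _ fun u hu => ?_
      obtain ⟨v, rfl⟩ := Fin.exists_succ_eq.2 hu.ne'
      simp
    have h1 : ∀ t a (J : Fin T → A), g (Fin.succ t) (Fin.cons a J : Fin (T + 1) → A) =
        g (Fin.succ t) (Fin.cons a₀ J : Fin (T + 1) → A) := by
      refine fun t a J => hg _ _ _ fun u hu => ?_
      obtain ⟨v, rfl⟩ := Fin.exists_succ_eq.2 ((Fin.succ_pos t).trans hu).ne'
      simp
    have h2 : ∀ (J : Fin T → A) a,
        ∏ t, w (g t (Fin.cons a J : Fin (T + 1) → A)) ((Fin.cons a J : Fin (T + 1) → A) t) =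
          w (g 0 (Fin.cons a₀ J : Fin (T + 1) → A)) a *
            ∏ t, w (g (Fin.succ t) (Fin.cons a₀ J : Fin (T + 1) → A)) (J t) := by
      intro J a
      rw [Fin.prod_univ_succ, h0 a J, Fin.cons_zero]
      congr 1
      exact Finset.prod_congr rfl fun t _ => by rw [h1 t a J, Fin.cons_succ]
    have h3 : ∀ J : Fin T → A, ∑ a, ∏ t, w (g t (Fin.consEquiv (fun _ => A) (a, J)))
        (Fin.consEquiv (fun _ => A) (a, J) t) =
          ∏ t, w (g (Fin.succ t) (Fin.cons a₀ J : Fin (T + 1) → A)) (J t) := by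
      intro J
      refine (Finset.sum_congr rfl fun a _ => h2 J a).trans ?_
      rw [← Finset.sum_mul, hw, one_mul]
    refine (Finset.sum_congr rfl fun J _ => h3 J).trans ?_
    refine ih (fun t J => g t.succ (Fin.cons a₀ J : Fin (T + 1) → A)) fun t J J' h => ?_
    refine hg _ _ _ fun u hu => ?_
    obtain ⟨v, rfl⟩ := Fin.exists_succ_eq.2 ((Fin.succ_pos t).trans hu).ne'
    simpa using h v (Fin.succ_lt_succ_iff.1 hu)

/-- Multiplied by 8 and exponentiated, this is 4^8 (q - 1)^2 ≤ 3^6 q^7. It says that a guess that is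
right three times in four carries at least an eighth of the information in a letter. -/
theorem log_div_eight_le {q : ℝ} (hq : 2 ≤ q) :
    Real.log q / 8 ≤
      Real.log q + (3 / 4 * Real.log (3 / 4) + 1 / 4 * Real.log (1 / (4 * (q - 1)))) := by
  have hq1 : 0 < q - 1 := by linarith
  have h : Real.log (65536 * (q - 1) ^ 2) ≤ Real.log (729 * q ^ 7) := by
    apply Real.log_le_log (by positivity)
    have h1 : q - 1 ≤ q ^ 2 / 4 := by nlinarith [sq_nonneg (q - 2)]
    have h2 : (q - 1) ^ 2 ≤ (q ^ 2 / 4) ^ 2 := by gcongr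
    have h3 : (2 : ℝ) ^ 3 ≤ q ^ 3 := by gcongr
    have h4 : 0 ≤ q ^ 4 := by positivity
    nlinarith
  rw [Real.log_mul (by norm_num) (by positivity), Real.log_mul (by norm_num) (by positivity),
    Real.log_pow, Real.log_pow, show (65536 : ℝ) = 4 ^ 8 by norm_num,
    show (729 : ℝ) = 3 ^ 6 by norm_num, Real.log_pow, Real.log_pow] at h
  rw [Real.log_div (by norm_num) (by norm_num), Real.log_div (by norm_num) (by positivity),
    Real.log_mul (by norm_num) (by positivity), Real.log_one]
  push_cast at h
  linarith

/-- Augmented indexing: if the letters of a word can be recovered from a message and the later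
letters, with at most a quarter of all attempts failing, then the message is long. -/
theorem mul_log_card_le_of_predictors {A M : Type*} [Fintype A] [Fintype M] [DecidableEq A]
    (hA : 2 ≤ Fintype.card A) {T : ℕ} (f : (Fin T → A) → M) (g : Fin T → M → (Fin T → A) → A)
    (hg : ∀ t m J J', (∀ u, t < u → J u = J' u) → g t m J = g t m J')
    (hbad : ∑ J : Fin T → A, ∑ t, (if g t (f J) J = J t then 0 else 1 : ℝ) ≤
      T * (Fintype.card A : ℝ) ^ T / 4) :
    T * Real.log (Fintype.card A) ≤ 8 * Real.log (Fintype.card M) := by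
  have : Nonempty A := Fintype.card_pos_iff.1 (by omega)
  set q : ℝ := (Fintype.card A : ℝ) with hq
  have hq2 : 2 ≤ q := by rw [hq]; exact_mod_cast hA
  have hq1 : 0 < q - 1 := by linarith
  -- The predicted letter gets the guaranteed success rate; the other `q - 1` letters share the rest
  -- equally.
  set α : ℝ := 3 / 4 with hα
  set β : ℝ := 1 / (4 * (q - 1)) with hβ
  have hβ0 : 0 < β := by positivity
  have hβα : β ≤ α := by
    rw [hβ, hα, div_le_div_iff₀ (by positivity) (by norm_num)]
    linarith
  let w : A → A → ℝ := fun a b => if a = b then α else β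
  have hw0 : ∀ a b, 0 < w a b := fun a b => by
    simp only [w]
    split_ifs
    · norm_num [hα]
    · exact hβ0
  have hw : ∀ a, ∑ b, w a b = 1 := fun a => by
    have : ∀ b, w a b = β + if a = b then α - β else 0 := fun b => by
      simp only [w]
      split_ifs <;> ring
    simp only [this, Finset.sum_add_distrib, Finset.sum_const, Finset.sum_ite_eq, Finset.mem_univ,
      if_true, Finset.card_univ, nsmul_eq_mul, ← hq]
    rw [hβ, hα]
    field_simp
    ring
  have hsum : ∑ J : Fin T → A, ∏ t, w (g t (f J) J) (J t) ≤ (Fintype.card M : ℝ) := by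
    calc ∑ J : Fin T → A, ∏ t, w (g t (f J) J) (J t)
        ≤ ∑ J : Fin T → A, ∑ m, ∏ t, w (g t m J) (J t) :=
          Finset.sum_le_sum fun J _ => Finset.single_le_sum
            (f := fun m => ∏ t, w (g t m J) (J t))
            (fun m _ => Finset.prod_nonneg fun t _ => (hw0 _ _).le) (Finset.mem_univ (f J))
      _ = ∑ m : M, ∑ J : Fin T → A, ∏ t, w (g t m J) (J t) := Finset.sum_comm
      _ = ∑ _m : M, (1 : ℝ) :=
          Finset.sum_congr rfl fun m _ => sum_prod_predictor w hw (fun t => g t m) fun t => hg t m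
      _ = Fintype.card M := by simp
  set ℓ : ℝ := 3 / 4 * Real.log α + 1 / 4 * Real.log β with hℓ
  have hcard : (Fintype.card (Fin T → A) : ℝ) = q ^ T := by simp [hq]
  have hlog : Real.log β ≤ Real.log α := Real.log_le_log hβ0 hβα
  have hlow : q ^ T * Real.exp (T * ℓ) ≤ ∑ J : Fin T → A, ∏ t, w (g t (f J) J) (J t) := by
    have h1 : ∀ J : Fin T → A, ∏ t, w (g t (f J) J) (J t) = Real.exp
        (T * Real.log α -
          (Real.log α - Real.log β) * ∑ t, if g t (f J) J = J t then (0 : ℝ) else 1) := by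
      intro J
      rw [Finset.mul_sum, show (T : ℝ) * Real.log α = ∑ _t : Fin T, Real.log α by simp,
        ← Finset.sum_sub_distrib, Real.exp_sum]
      refine Finset.prod_congr rfl fun t _ => ?_
      simp only [w]
      split_ifs
      · simp [Real.exp_log (show (0 : ℝ) < α by norm_num [hα])]
      · simp [Real.exp_log hβ0]
    -- Jensen's inequality by hand: the tangent to exp at `T * ℓ` makes the bound linear in the
    -- number of failures, so only their average counts.
    have h2 : ∀ J : Fin T → A, Real.exp (T * ℓ) * (1 + (T * Real.log α -
        (Real.log α - Real.log β) * ∑ t, if g t (f J) J = J t then (0 : ℝ) else 1) - T * ℓ) ≤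
        ∏ t, w (g t (f J) J) (J t) := by
      intro J
      rw [h1]
      set u : ℝ := T * Real.log α -
        (Real.log α - Real.log β) * ∑ t, if g t (f J) J = J t then (0 : ℝ) else 1
      have h3 := Real.add_one_le_exp (u - T * ℓ)
      calc Real.exp (T * ℓ) * (1 + u - T * ℓ) ≤ Real.exp (T * ℓ) * Real.exp (u - T * ℓ) := by
            gcongr
            linarith
        _ = Real.exp u := by rw [← Real.exp_add]; ring_nf
    refine le_trans ?_ (Finset.sum_le_sum fun J _ => h2 J)
    rw [← Finset.mul_sum, mul_comm]
    gcongr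
    rw [Finset.sum_sub_distrib, Finset.sum_add_distrib, Finset.sum_sub_distrib]
    simp only [Finset.sum_const, Finset.card_univ, nsmul_eq_mul, hcard, mul_one]
    rw [← Finset.mul_sum]
    have := mul_le_mul_of_nonneg_left hbad (sub_nonneg.2 hlog)
    rw [hℓ]
    nlinarith
  have h := Real.log_le_log (by positivity) (hlow.trans hsum)
  rw [Real.log_mul (by positivity) (by positivity), Real.log_exp, Real.log_pow] at h
  have h4 := mul_le_mul_of_nonneg_left (log_div_eight_le hq2) (Nat.cast_nonneg (α := ℝ) T)
  rw [← hα, ← hβ, ← hℓ] at h4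
  linarith

/-! ### Fixing the random bits -/

/-- Among finitely many events of probability at most `1 / 4`, some outcome lies in at most
a quarter. -/
theorem exists_sum_indicator_le {Ω ι : Type*} [MeasurableSpace Ω] [Fintype ι]
    (μ : MeasureTheory.Measure Ω) [MeasureTheory.IsProbabilityMeasure μ] (F : ι → Set Ω)
    (hF : ∀ i, μ (F i) ≤ 1 / 4) :
    ∃ ω, ∑ i, (F i).indicator (fun _ => (1 : ℝ)) ω ≤ (Fintype.card ι : ℝ) / 4 := by
  -- The events need not be measurable; measurable hulls have the same measure.
  let G : ι → Set Ω := fun i => MeasureTheory.toMeasurable μ (F i)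
  have hG : ∀ i, MeasurableSet (G i) := fun i => MeasureTheory.measurableSet_toMeasurable _ _
  have hGF : ∀ i, F i ⊆ G i := fun i => MeasureTheory.subset_toMeasurable _ _
  have hint : ∀ i, MeasureTheory.Integrable ((G i).indicator fun _ => (1 : ℝ)) μ := fun i =>
    (MeasureTheory.integrable_const 1).indicator (hG i)
  obtain ⟨ω, hω⟩ := MeasureTheory.exists_le_integral
    (MeasureTheory.integrable_finsetSum Finset.univ fun i _ => hint i)
  refine ⟨ω, ?_⟩
  calc ∑ i, (F i).indicator (fun _ => (1 : ℝ)) ω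
      ≤ ∑ i, (G i).indicator (fun _ => (1 : ℝ)) ω := Finset.sum_le_sum fun i _ =>
        Set.indicator_le_indicator_of_subset (hGF i) (fun _ => zero_le_one) ω
    _ ≤ ∫ ω, ∑ i, (G i).indicator (fun _ => (1 : ℝ)) ω ∂μ := hω
    _ = ∑ i, μ.real (G i) := by
        rw [MeasureTheory.integral_finsetSum _ fun i _ => hint i]
        refine Finset.sum_congr rfl fun i _ => ?_
        rw [MeasureTheory.integral_indicator_const _ (hG i), smul_eq_mul, mul_one]
    _ ≤ ∑ _i : ι, 1 / 4 := by
        refine Finset.sum_le_sum fun i _ => ?_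
        have h := hF i
        rw [← MeasureTheory.measure_toMeasurable] at h
        have := ENNReal.toReal_mono (by norm_num) h
        simpa [MeasureTheory.Measure.real, G] using this
    _ = (Fintype.card ι : ℝ) / 4 := by simp; ring

/-! ### Integer codes from the doubling constant -/

/-- If `S` is not covered by fewer than `m` half balls, some ball contains `m` well-separated
points. -/
theorem exists_separated_of_not_covers {E : Type*} [AddCommGroup E] [Module ℝ E]
    {N : Seminorm ℝ E} {S : Set E} {m : ℕ} (h : ¬ CoversByHalfBalls N S m) :
    ∃ p ∈ S, ∃ r : ℝ, 0 < r ∧ ∃ y : Fin (m + 1) → E, (∀ j, y j ∈ S ∧ N (y j - p) ≤ r) ∧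
      ∀ i j, i ≠ j → r / 2 < N (y i - y j) := by
  classical
  simp only [CoversByHalfBalls] at h
  push Not at h
  obtain ⟨p, hp, r, hr, h⟩ := h
  refine ⟨p, hp, r, hr, ?_⟩
  -- Greedy choice: at most `m` points found so far are centers of half balls that miss some point
  -- of the ball.
  have key : ∀ l ≤ m + 1, ∃ y : Fin l → E, (∀ j, y j ∈ S ∧ N (y j - p) ≤ r) ∧
      ∀ i j, i ≠ j → r / 2 < N (y i - y j) := by
    intro l
    induction l with
    | zero => exact fun _ => ⟨Fin.elim0, fun j => j.elim0, fun j => j.elim0⟩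
    | succ l ih =>
      intro hl
      obtain ⟨y, hy, hsep⟩ := ih (by omega)
      obtain ⟨z, hz, hzr, hzy⟩ := h (Finset.univ.image y)
        (by simpa [Set.range_subset_iff] using fun j => (hy j).1)
        (Finset.card_image_le.trans (by simpa using hl))
      have hz' : ∀ j, r / 2 < N (z - y j) := fun j => hzy _ (by simp)
      refine ⟨Fin.cons z y, fun j => ?_, fun i j hij => ?_⟩
      · refine Fin.cases ?_ (fun j => ?_) j
        · exact ⟨hz, hzr⟩
        · simpa using hy j
      · induction i using Fin.cases with
        | zero =>
          induction j using Fin.cases with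
          | zero => exact absurd rfl hij
          | succ j => simpa using hz' j
        | succ i =>
          induction j using Fin.cases with
          | zero => simpa [map_sub_rev] using hz' i
          | succ j => simpa using hsep i j fun e => hij (by rw [e])
  exact key _ le_rfl

theorem EuclideanSpace.norm_le_card_of_abs_le_one {n : ℕ} {x : EuclideanSpace ℝ (Fin n)}
    (hx : ∀ i, |x i| ≤ 1) : ‖x‖ ≤ n := by
  rw [EuclideanSpace.norm_eq]
  apply Real.sqrt_le_iff.2 ⟨by positivity, ?_⟩
  have h : ∑ i, ‖x i‖ ^ 2 ≤ ∑ _i : Fin n, (1 : ℝ) :=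
    Finset.sum_le_sum fun i _ => by
      rw [Real.norm_eq_abs]
      exact pow_le_one₀ (abs_nonneg _) (hx i)
  simp only [Finset.sum_const, Finset.card_univ, Fintype.card_fin, nsmul_eq_mul, mul_one] at h
  rcases Nat.eq_zero_or_pos n with rfl | hn
  · simp
  · have : (1 : ℝ) ≤ n := by exact_mod_cast hn
    nlinarith

/-- The vector of `ℝⁿ` with given integer coordinates. -/
noncomputable def intVector {n : ℕ} (v : Fin n → ℤ) : EuclideanSpace ℝ (Fin n) :=
  WithLp.toLp 2 fun i => (v i : ℝ)

@[simp]
theorem intVector_apply {n : ℕ} (v : Fin n → ℤ) (i : Fin n) : intVector v i = v i := rfl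

/-- Well-separated integer points of bounded height among the non-negative sparse vectors, as many
as the doubling constant. -/
theorem exists_integer_code {n k c : ℕ} (hn : 0 < n) {N : Seminorm ℝ (EuclideanSpace ℝ (Fin n))}
    (hN : HasPolyAspectRatio c N) {m : ℕ} (hm : ¬ CoversByHalfBalls N (nonnegSparse n k) m) :
    ∃ y : Fin (m + 1) → Fin n → ℤ,
      (∀ j i, 0 ≤ y j i ∧ y j i ≤ 24 * (n : ℤ) ^ (2 * c + 1)) ∧
      (∀ j, IsSparse k (intVector (y j))) ∧
      (∀ i j, i ≠ j → 2 * (n : ℝ) ^ (c + 1) < N (intVector (y i) - intVector (y j))) ∧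
      ∀ i j, N (intVector (y i) - intVector (y j)) ≤ 18 * (n : ℝ) ^ (c + 1) := by
  obtain ⟨p, hp, r, hr, y, hy, hsep⟩ := exists_separated_of_not_covers hm
  have hn0 : (0 : ℝ) < n := by exact_mod_cast hn
  set e : ℝ := (n : ℝ) ^ (c + 1) with he
  have he0 : 0 < e := by positivity
  -- Rounding moves each point by at most `e`. After scaling, the separation `r / 2` becomes `4 * e`
  -- and the diameter `2 * r` becomes `16 * e`; rounding changes either by at most `2 * e`.
  set σ : ℝ := 8 * e / r with hσ
  have hσ0 : 0 < σ := by positivity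
  set B : ℝ := (n : ℝ) ^ c * r with hB
  have hB0 : 0 < B := by positivity
  have hz : ∀ j i, |y j i - p i| ≤ B := fun j i => by
    have h1 := (PiLp.norm_apply_le (y j - p) i).trans (hN (y j - p)).1
    rw [Real.norm_eq_abs, PiLp.sub_apply] at h1
    exact h1.trans (mul_le_mul_of_nonneg_left (hy j).2 (by positivity))
  -- The center may have huge coordinates. Cutting them at `2 * B` translates all points alike, so
  -- differences survive. A cut coordinate stays at least `B`, so non-negativity survives, and no
  -- zero coordinate is touched.
  let u : Fin (m + 1) → Fin n → ℝ := fun j i => min (p i) (2 * B) + (y j i - p i)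
  have hu : ∀ j i, 0 ≤ u j i ∧ u j i ≤ 3 * B ∧ (y j i = 0 → u j i = 0) := by
    intro j i
    have h1 := abs_le.1 (hz j i)
    have h2 := (hy j).1.2 i
    simp only [u]
    rcases min_cases (p i) (2 * B) with ⟨h, h'⟩ | ⟨h, h'⟩ <;> rw [h]
    · exact ⟨by linarith, by linarith, fun h0 => by linarith⟩
    · exact ⟨by linarith, by linarith, fun h0 => by linarith⟩
  have hu_sub : ∀ i j, N (WithLp.toLp 2 (u i) - WithLp.toLp 2 (u j)) = N (y i - y j) := by
    intro i j
    congr 1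
    ext l
    simp [u]
  let q : Fin (m + 1) → Fin n → ℤ := fun j i => ⌊σ * u j i⌋
  have hfr : ∀ j, N (intVector (q j) - σ • WithLp.toLp 2 (u j)) ≤ e := by
    intro j
    refine (hN _).2.trans ?_
    rw [he, pow_succ]
    gcongr
    refine EuclideanSpace.norm_le_card_of_abs_le_one fun i => ?_
    have h1 := Int.floor_le (σ * u j i)
    have h2 := Int.lt_floor_add_one (σ * u j i)
    simp only [PiLp.sub_apply, intVector_apply, PiLp.smul_apply, smul_eq_mul, q]
    rw [abs_le]
    constructor <;> linarith
  have hdecomp : ∀ i j, intVector (q i) - intVector (q j) =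
      σ • (WithLp.toLp 2 (u i) - WithLp.toLp 2 (u j)) +
        ((intVector (q i) - σ • WithLp.toLp 2 (u i)) -
          (intVector (q j) - σ • WithLp.toLp 2 (u j))) := by
    intro i j
    rw [smul_sub]
    abel
  have herr : ∀ i j, N ((intVector (q i) - σ • WithLp.toLp 2 (u i)) -
      (intVector (q j) - σ • WithLp.toLp 2 (u j))) ≤ 2 * e := fun i j => by
    refine (map_sub_le_add N _ _).trans ?_
    linarith [hfr i, hfr j]
  have hmain : ∀ i j, N (σ • (WithLp.toLp 2 (u i) - WithLp.toLp 2 (u j))) =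
      σ * N (y i - y j) := fun i j => by
    rw [map_smul_eq_mul, Real.norm_of_nonneg hσ0.le, hu_sub]
  have hσr : σ * r = 8 * e := by
    rw [hσ]
    field_simp
  refine ⟨q, fun j i => ⟨?_, ?_⟩, fun j => ?_, fun i j hij => ?_, fun i j => ?_⟩
  · exact Int.floor_nonneg.2 (mul_nonneg hσ0.le (hu j i).1)
  · have h1 : σ * u j i ≤ 24 * (n : ℝ) ^ (2 * c + 1) := by
      calc σ * u j i ≤ σ * (3 * B) := by gcongr; exact (hu j i).2.1
        _ = 3 * (n : ℝ) ^ c * (σ * r) := by rw [hB]; ring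
        _ = 24 * (n : ℝ) ^ (2 * c + 1) := by rw [hσr, he]; ring
    have h2 := (Int.floor_le (σ * u j i)).trans h1
    exact_mod_cast h2
  · refine (Set.ncard_le_ncard (fun i hi => ?_) (Set.toFinite _)).trans (hy j).1.1
    simp only [Set.mem_ofPred_eq, intVector_apply, q] at hi ⊢
    intro h0
    exact hi (by simp [(hu j i).2.2 h0])
  · have h1 := mul_lt_mul_of_pos_left (hsep i j hij) hσ0
    have h2 := map_sub_le_add N (intVector (q i) - intVector (q j))
      ((intVector (q i) - σ • WithLp.toLp 2 (u i)) -
          (intVector (q j) - σ • WithLp.toLp 2 (u j)))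
    rw [eq_sub_of_add_eq (hdecomp i j).symm |>.symm, hmain] at h2
    linarith [herr i j]
  · have h1 : N (y i - y j) ≤ 2 * r := by
      rw [← sub_sub_sub_cancel_right _ _ p]
      refine (map_sub_le_add N _ _).trans ?_
      linarith [(hy i).2, (hy j).2]
    have h2 := mul_le_mul_of_nonneg_left h1 hσ0.le
    rw [hdecomp]
    refine (map_add_le_add N _ _).trans ?_
    rw [hmain]
    linarith [herr i j]

/-! ### Streams that add and subtract vectors -/

section streams

variable {n : ℕ}

theorem streamVector_append (l l' : List (TurnstileUpdate n)) :
    streamVector (l ++ l') = streamVector l + streamVector l' := by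
  simp [streamVector]

theorem streamVector_map_of_nodup (v : Fin n → ℤ) {L : List (Fin n)} (hL : L.Nodup) (i : Fin n) :
    streamVector (L.map fun j => (j, v j)) i = if i ∈ L then v i else 0 := by
  induction L with
  | nil => simp [streamVector]
  | cons j L ih =>
    have h : streamVector ((j :: L).map fun j => (j, v j)) =
        Pi.single j (v j) + streamVector (L.map fun j => (j, v j)) := by
      simp [streamVector]
    rw [h, Pi.add_apply, ih (List.nodup_cons.1 hL).2]
    have := (List.nodup_cons.1 hL).1
    by_cases hij : i = j
    · subst hij
      simp [this]
    · simp [hij]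

/-- The stream that adds `v` to the vector, one coordinate after the other. -/
def addStream (v : Fin n → ℤ) : List (TurnstileUpdate n) :=
  (List.finRange n).map fun i => (i, v i)

@[simp]
theorem length_addStream (v : Fin n → ℤ) : (addStream v).length = n := by
  simp [addStream]

@[simp]
theorem streamVector_addStream (v : Fin n → ℤ) : streamVector (addStream v) = v := by
  ext i
  simp [addStream, streamVector_map_of_nodup v (List.nodup_finRange n)]

theorem streamVector_of_prefix_addStream {v : Fin n → ℤ} {l : List (TurnstileUpdate n)}
    (h : l <+: addStream v) (i : Fin n) : streamVector l i = 0 ∨ streamVector l i = v i := by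
  obtain ⟨L, hL, rfl⟩ := (List.prefix_map_iff).1 h
  rw [streamVector_map_of_nodup v (hL.sublist.nodup (List.nodup_finRange n))]
  split_ifs <;> simp

/-- Adding a vector and then subtracting a smaller one is a legal stream. -/
theorem isPromisedStream_add_sub {M : ℤ} {v b : Fin n → ℤ} (hb : ∀ i, 0 ≤ b i)
    (hbv : ∀ i, b i ≤ v i) (hv : ∀ i, v i ≤ M) :
    IsPromisedStream M (addStream v ++ addStream (-b)) := by
  intro l hl i
  have h1 := hb i
  have h2 := hbv i
  have h3 := hv i
  -- Each half touches a coordinate once, so its only values are 0, `v i` and `v i - b i`.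
  rcases List.prefix_or_prefix_of_prefix hl (List.prefix_append _ _) with h | ⟨l', rfl⟩
  · rcases streamVector_of_prefix_addStream h i with h | h <;> rw [h] <;> omega
  · have h := (List.prefix_append_right_inj _).1 hl
    rw [streamVector_append, streamVector_addStream, Pi.add_apply]
    rcases streamVector_of_prefix_addStream h i with h | h <;> rw [h] <;>
      try rw [Pi.neg_apply]
    all_goals omega

theorem realStreamVector_add_sub (v b : Fin n → ℤ) :
    realStreamVector (addStream v ++ addStream (-b)) = intVector (v - b) := by
  ext i
  simp [realStreamVector, streamVector_append, sub_eq_add_neg]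

namespace StreamingAlgorithm

variable {s : ℕ} {Ω : Type*}

theorem runFrom_append (alg : StreamingAlgorithm n s Ω) (ω : Ω) (t : ℕ) (m : Fin s → Bool)
    (l l' : List (TurnstileUpdate n)) :
    alg.runFrom ω t m (l ++ l') = alg.runFrom ω (t + l.length) (alg.runFrom ω t m l) l' := by
  induction l generalizing t m with
  | nil => rfl
  | cons u l ih =>
    rw [List.cons_append, runFrom, runFrom, ih, List.length_cons]
    congr 1
    omega

/-- Separates the message (memory after the first half) from what the decoder does with it. Both
halves have length `n`, so the update counter reveals nothing. -/
theorem result_add_append (alg : StreamingAlgorithm n s Ω) (ω : Ω) (v b : Fin n → ℤ) :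
    alg.result ω (addStream v ++ addStream b) = alg.output ω (n + n)
      (alg.runFrom ω n (alg.runFrom ω 0 (alg.init ω) (addStream v)) (addStream b)) := by
  simp [result, runFrom_append]

end StreamingAlgorithm

end streams

/-! ### Decoding a letter -/

theorem IsSparse.smul {n k : ℕ} {x : EuclideanSpace ℝ (Fin n)} (hx : IsSparse k x) (a : ℝ) :
    IsSparse k (a • x) := by
  refine (Set.ncard_le_ncard (fun i hi => ?_) (Set.toFinite _)).trans hx
  simp only [Set.mem_ofPred_eq, PiLp.smul_apply, smul_eq_mul] at hi ⊢
  exact right_ne_zero_of_mul hi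

section decoding

variable {n T : ℕ} {A : Type*}

/-- The combination of the code words of the letters at positions in `I`, with weights `D ^ u`. -/
def codeSum (y : A → Fin n → ℤ) (D : ℕ) (I : Finset (Fin T)) (J : Fin T → A) : Fin n → ℤ :=
  ∑ u ∈ I, (D : ℤ) ^ (u : ℕ) • y (J u)

theorem intVector_codeSum (y : A → Fin n → ℤ) (D : ℕ) (I : Finset (Fin T)) (J : Fin T → A) :
    intVector (codeSum y D I J) = ∑ u ∈ I, (D : ℝ) ^ (u : ℕ) • intVector (y (J u)) := by
  ext i
  simp [codeSum, Finset.sum_apply]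

theorem sum_Iio_pow_mul_le (D : ℕ) (t : Fin T) :
    (∑ u ∈ Finset.Iio t, (D : ℝ) ^ (u : ℕ)) * (D - 1) ≤ (D : ℝ) ^ (t : ℕ) := by
  have h : ∑ u ∈ Finset.Iio t, (D : ℝ) ^ (u : ℕ) = ∑ u ∈ Finset.range t, (D : ℝ) ^ u := by
    rw [← Nat.Iio_eq_range, ← Fin.map_valEmbedding_Iio, Finset.sum_map]
    rfl
  rw [h, geom_sum_mul]
  linarith

/-- The combination of the letters up to `t` is close to a multiple of the code word of the
letter at `t`. -/
theorem seminorm_codeSum_sub_le {N : Seminorm ℝ (EuclideanSpace ℝ (Fin n))}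
    {y : A → Fin n → ℤ} {R : ℝ} (hR : ∀ a b, N (intVector (y a) - intVector (y b)) ≤ R)
    {D : ℕ} (t : Fin T) (J : Fin T → A) :
    N (intVector (codeSum y D (Finset.Iic t) J) -
      (∑ u ∈ Finset.Iic t, (D : ℝ) ^ (u : ℕ)) • intVector (y (J t))) ≤
      (∑ u ∈ Finset.Iio t, (D : ℝ) ^ (u : ℕ)) * R := by
  -- The term at `t` cancels; the others are weighted differences of code words.
  rw [intVector_codeSum, Finset.sum_smul, ← Finset.sum_sub_distrib, ← Finset.Iio_insert,
    Finset.sum_insert (by simp), sub_self, zero_add, Finset.sum_mul]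
  refine (Finset.le_sum_of_subadditive N (map_zero N).le (map_add_le_add N) _ _).trans (Finset.sum_le_sum fun u _ => ?_)
  rw [← smul_sub, map_smul_eq_mul, Real.norm_of_nonneg (by positivity)]
  exact mul_le_mul_of_nonneg_left (hR _ _) (by positivity)

end decoding

/-- A streaming algorithm for sparse approximation needs memory proportional to the number of
digits in base `D` times the logarithm of the size of a code of bounded aspect ratio. -/
theorem StreamingAlgorithm.Solves.mul_log_card_le {n k s T : ℕ} {Ω A : Type*} [MeasurableSpace Ω]
    [Fintype A] [DecidableEq A] {μ : MeasureTheory.Measure Ω} [MeasureTheory.IsProbabilityMeasure μ]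
    {alg : StreamingAlgorithm n s Ω} {N : Seminorm ℝ (EuclideanSpace ℝ (Fin n))} {K : ℝ} {M : ℤ}
    (hsolve : alg.Solves μ N k K M) (hK : 0 ≤ K) (hA : 2 ≤ Fintype.card A)
    {y : A → Fin n → ℤ} (hy0 : ∀ a i, 0 ≤ y a i) (hyk : ∀ a, IsSparse k (intVector (y a)))
    {e : ℝ} (he : 0 < e) (hsep : ∀ a b, a ≠ b → 2 * e < N (intVector (y a) - intVector (y b)))
    (hdiam : ∀ a b, N (intVector (y a) - intVector (y b)) ≤ 18 * e)
    {D : ℕ} (hD : 18 * K + 19 ≤ D)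
    (hM : ∀ J : Fin T → A, ∀ i, codeSum y D Finset.univ J i ≤ M) :
    T * Real.log (Fintype.card A) ≤ 8 * (s * Real.log 2) := by
  classical
  have hD1 : (0 : ℝ) < D := by linarith
  let b : Fin T → (Fin T → A) → Fin n → ℤ := fun t J => codeSum y D (Finset.Ioi t) J
  have hsplit : ∀ t J, codeSum y D Finset.univ J = codeSum y D (Finset.Iic t) J + b t J := by
    intro t J
    simp only [b, codeSum]
    rw [← Finset.sum_union]
    · congr 1
      ext u
      simp [le_or_gt]
    · exact Finset.disjoint_left.2 fun u h1 h2 =>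
        (Finset.mem_Ioi.1 h2).not_ge (Finset.mem_Iic.1 h1)
  have hnonneg : ∀ I J i, 0 ≤ codeSum y D (T := T) I J i := by
    intro I J i
    simp only [codeSum, Finset.sum_apply, Pi.smul_apply, smul_eq_mul]
    exact Finset.sum_nonneg fun u _ => mul_nonneg (by positivity) (hy0 _ _)
  let l : Fin T → (Fin T → A) → List (TurnstileUpdate n) := fun t J =>
    addStream (codeSum y D Finset.univ J) ++ addStream (-b t J)
  have hl : ∀ t J, IsPromisedStream M (l t J) := fun t J =>
    isPromisedStream_add_sub (fun i => hnonneg _ _ i)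
      (fun i => by rw [hsplit t J, Pi.add_apply]; linarith [hnonneg (Finset.Iic t) J i])
      (fun i => hM J i)
  have hlv : ∀ t J, realStreamVector (l t J) = intVector (codeSum y D (Finset.Iic t) J) := by
    intro t J
    rw [realStreamVector_add_sub, hsplit t J, add_sub_cancel_right]
  let F : (Fin T → A) × Fin T → Set Ω := fun i =>
    {ω | ¬ IsApproxSparse N k K (realStreamVector (l i.2 i.1)) (alg.result ω (l i.2 i.1))}
  obtain ⟨ω, hω⟩ := exists_sum_indicator_le μ F fun i => hsolve _ (hl i.2 i.1)
  let S : Fin T → ℝ := fun t => ∑ u ∈ Finset.Iic t, (D : ℝ) ^ (u : ℕ)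
  have hA0 : Nonempty A := Fintype.card_pos_iff.1 (by omega)
  -- The radius is at most half the separation of the multiples `S t • intVector (y a)`, because `D
  -- ^ t ≤ S t`.
  let near : Fin T → EuclideanSpace ℝ (Fin n) → A → Prop := fun t o a =>
    N (o - S t • intVector (y a)) ≤ (D : ℝ) ^ (t : ℕ) * e
  have hnear : ∀ t o a a', near t o a → near t o a' → a = a' := by
    intro t o a a' h h'
    by_contra hne
    have h1 : N (S t • intVector (y a) - S t • intVector (y a')) ≤
        2 * ((D : ℝ) ^ (t : ℕ) * e) := by
      rw [← sub_sub_sub_cancel_left _ _ o]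
      refine (map_sub_le_add N _ _).trans ?_
      simp only [near] at h h'
      linarith
    have hS : (D : ℝ) ^ (t : ℕ) ≤ S t :=
      Finset.single_le_sum (f := fun u : Fin T => (D : ℝ) ^ (u : ℕ))
        (fun u _ => by positivity) (Finset.mem_Iic.2 le_rfl)
    have hp : 0 < (D : ℝ) ^ (t : ℕ) := by positivity
    rw [← smul_sub, map_smul_eq_mul, Real.norm_of_nonneg (hp.le.trans hS)] at h1
    have h2 := hsep a a' hne
    have h3 := mul_le_mul_of_nonneg_right hS (apply_nonneg N (intVector (y a) - intVector (y a')))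
    nlinarith
  let dec : Fin T → EuclideanSpace ℝ (Fin n) → A := fun t o =>
    if h : ∃ a, near t o a then h.choose else hA0.some
  have hdec : ∀ t o a, near t o a → dec t o = a := by
    intro t o a h
    have h' : ∃ a, near t o a := ⟨a, h⟩
    simp only [dec, dif_pos h']
    exact hnear t o _ _ h'.choose_spec h
  have hgood : ∀ t J, IsApproxSparse N k K (realStreamVector (l t J)) (alg.result ω (l t J)) →
      dec t (alg.result ω (l t J)) = J t := by
    intro t J h
    apply hdec
    -- The sparse competitor is the multiple of the code word itself. The triangle inequality then
    -- costs the factor `K + 1`.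
    have h1 := h (S t • intVector (y (J t))) ((hyk (J t)).smul _)
    rw [hlv] at h1
    have h2 := seminorm_codeSum_sub_le hdiam (D := D) t J
    have h3 : N (alg.result ω (l t J) - S t • intVector (y (J t))) ≤
        (K + 1) * ((∑ u ∈ Finset.Iio t, (D : ℝ) ^ (u : ℕ)) * (18 * e)) := by
      rw [← sub_sub_sub_cancel_left _ _ (intVector (codeSum y D (Finset.Iic t) J))]
      refine (map_sub_le_add N _ _).trans ?_
      have := mul_le_mul_of_nonneg_left h2 hK
      linarith
    refine h3.trans ?_
    have h4 := sum_Iio_pow_mul_le D t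
    set σ := ∑ u ∈ Finset.Iio t, (D : ℝ) ^ (u : ℕ)
    have hσ : 0 ≤ σ := Finset.sum_nonneg fun u _ => by positivity
    -- This is where `18 * K + 19 ≤ D` is needed: the total weight before `t` is at most `D ^ t / (D
    -- - 1)`.
    have h5 : σ * (18 * (K + 1)) ≤ σ * (D - 1) := mul_le_mul_of_nonneg_left (by linarith) hσ
    have h6 := mul_le_mul_of_nonneg_right (h5.trans h4) he.le
    linarith
  have hmain := mul_log_card_le_of_predictors hA
    (fun J : Fin T → A => alg.runFrom ω 0 (alg.init ω) (addStream (codeSum y D Finset.univ J)))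
    (fun t m J => dec t (alg.output ω (n + n) (alg.runFrom ω n m (addStream (-b t J))))) ?_ ?_
  · simpa using hmain
  · intro t m J J' h
    have : b t J = b t J' := by
      simp only [b, codeSum]
      exact Finset.sum_congr rfl fun u hu => by rw [h u (Finset.mem_Ioi.1 hu)]
    simp only [this]
  · simp only [← StreamingAlgorithm.result_add_append]
    rw [Fintype.sum_prod_type] at hω
    have hc : (Fintype.card ((Fin T → A) × Fin T) : ℝ) / 4 =
        T * (Fintype.card A : ℝ) ^ T / 4 := by
      simp [mul_comm]
    rw [← hc]
    refine le_trans (Finset.sum_le_sum fun J _ => Finset.sum_le_sum fun t _ => ?_) hω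
    by_cases h : IsApproxSparse N k K (realStreamVector (l t J)) (alg.result ω (l t J))
    · rw [if_pos (hgood t J h)]
      exact Set.indicator_nonneg (fun _ _ => zero_le_one) _
    · rw [Set.indicator_of_mem (show ω ∈ F (J, t) from h)]
      split_ifs <;> norm_num

/-! ### Choice of parameters -/

/-- As `K > 2`, `K ^ 6 ≥ 32 * K ≥ 18 * K + 20`. The upper bound keeps log D within a constant factor
of log K. -/
theorem exists_base {K : ℝ} (hK : 2 < K) : ∃ D : ℕ, 18 * K + 19 ≤ D ∧ (D : ℝ) ≤ K ^ 6 := by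
  refine ⟨⌈18 * K + 19⌉₊, Nat.le_ceil _, (Nat.ceil_lt_add_one (by positivity)).le.trans ?_⟩
  have : (2 : ℝ) ^ 5 ≤ K ^ 5 := by gcongr
  nlinarith

/-- Code words of height at most `B` combine to a vector of height at most `2 * D ^ T * B`. -/
theorem codeSum_le {n T : ℕ} {A : Type*} {y : A → Fin n → ℤ} {B : ℤ} (hB : 0 ≤ B)
    (hy : ∀ a i, y a i ≤ B) {D : ℕ} (hD : 2 ≤ D) (J : Fin (T + 1) → A) (i : Fin n) :
    codeSum y D Finset.univ J i ≤ 2 * (D : ℤ) ^ T * B := by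
  have hgeom : ∀ T : ℕ, ∑ u : Fin (T + 1), (D : ℤ) ^ (u : ℕ) ≤ 2 * (D : ℤ) ^ T := by
    intro T
    induction T with
    | zero => simp
    | succ T ih =>
      have hD' : (2 : ℤ) ≤ D := by exact_mod_cast hD
      have hp : 0 ≤ (D : ℤ) ^ T := by positivity
      rw [Fin.sum_univ_castSucc]
      simp only [Fin.val_castSucc, Fin.val_last, pow_succ] at ih ⊢
      nlinarith
  simp only [codeSum, Finset.sum_apply, Pi.smul_apply, smul_eq_mul]
  calc ∑ u : Fin (T + 1), (D : ℤ) ^ (u : ℕ) * y (J u) i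
      ≤ ∑ u : Fin (T + 1), (D : ℤ) ^ (u : ℕ) * B :=
        Finset.sum_le_sum fun u _ => mul_le_mul_of_nonneg_left (hy _ _) (by positivity)
    _ = (∑ u : Fin (T + 1), (D : ℤ) ^ (u : ℕ)) * B := by rw [Finset.sum_mul]
    _ ≤ 2 * (D : ℤ) ^ T * B := mul_le_mul_of_nonneg_right (hgeom T) hB

theorem mainTheorem2 :
    ∃ γ : ℝ, 0 < γ ∧ ∀ c : ℕ, ∃ a₀ : ℕ, ∀ a : ℕ, a₀ ≤ a →
      ∀ (n k s : ℕ) (N : Seminorm ℝ (EuclideanSpace ℝ (Fin n))) (K : ℝ)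
        (Ω : Type*) [MeasurableSpace Ω] (μ : MeasureTheory.Measure Ω)
        [MeasureTheory.IsProbabilityMeasure μ] (alg : StreamingAlgorithm n s Ω),
        HasPolyAspectRatio c N → 2 < K → alg.Solves μ N k K ((n : ℤ) ^ a) →
        γ * (doublingDimension N (nonnegSparse n k) * (Real.log n / Real.log K)) ≤ (s : ℝ) := by
  -- The exponent is 6 for the constant 48 ≤ 2 ^ 6 ≤ `n ^ 6`, 6 for `D ^ T`, and `2 * c + 1` for the
  -- height of the code.
  refine ⟨1 / 8, by norm_num, fun c => ⟨2 * c + 13, fun a ha n k s N K Ω _ μ _ alg hN hK hsolve =>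
    ?_⟩⟩
  rcases lt_or_ge n 2 with hn | hn
  · have : Real.log n = 0 := by interval_cases n <;> simp
    simp [this]
  set m := doublingConstant N (nonnegSparse n k) with hm
  rcases lt_or_ge m 2 with hm2 | hm2
  · have : doublingDimension N (nonnegSparse n k) = 0 := by
      rw [doublingDimension, ← hm]
      interval_cases m <;> simp
    simp [this]
  -- By minimality `m - 1` half balls do not suffice, which yields a code of exactly `m` words.
  obtain ⟨m', hm'⟩ : ∃ m', m = m' + 1 := ⟨m - 1, by omega⟩
  have hncov : ¬ CoversByHalfBalls N (nonnegSparse n k) m' :=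
    Nat.notMem_of_lt_sInf (s := {m | CoversByHalfBalls N (nonnegSparse n k) m})
      (by change m' < m; omega)
  have hnR : (2 : ℝ) ≤ n := by exact_mod_cast hn
  have hn1 : 0 < Real.log n := Real.log_pos (by linarith)
  have hK1 : 0 < Real.log K := Real.log_pos (by linarith)
  obtain ⟨y, hy, hyk, hsep, hdiam⟩ := exists_integer_code (by omega) hN hncov
  obtain ⟨D, hD, hDK⟩ := exists_base hK
  -- The word has `T + 1` letters: this reaches log n / log K despite the floor, while the largest
  -- weight is only `D ^ T`.
  set T : ℕ := ⌊Real.log n / Real.log K⌋₊ with hT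
  have hT1 : Real.log n / Real.log K ≤ (T + 1 : ℕ) := by
    push_cast
    exact (Nat.lt_floor_add_one _).le
  have hT2 : (T : ℝ) * Real.log K ≤ Real.log n :=
    (le_div_iff₀ hK1).1 (Nat.floor_le (by positivity))
  have hD2 : 2 ≤ D := by
    have : (2 : ℝ) ≤ D := by linarith
    exact_mod_cast this
  have hDT : (D : ℤ) ^ T ≤ (n : ℤ) ^ 6 := by
    have h1 : K ^ T ≤ (n : ℝ) := by
      rw [← Real.log_le_log_iff (by positivity) (by linarith), Real.log_pow]
      exact hT2
    have h2 : (D : ℝ) ^ T ≤ (n : ℝ) ^ 6 := by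
      calc (D : ℝ) ^ T ≤ (K ^ 6) ^ T := by gcongr
        _ = (K ^ T) ^ 6 := by rw [← pow_mul, ← pow_mul, mul_comm]
        _ ≤ (n : ℝ) ^ 6 := by gcongr
    exact_mod_cast h2
  have hnZ : (2 : ℤ) ≤ n := by exact_mod_cast hn
  have hheight : ∀ (J : Fin (T + 1) → Fin (m' + 1)) i,
      codeSum y D Finset.univ J i ≤ (n : ℤ) ^ a := by
    intro J i
    refine (codeSum_le (by positivity) (fun a i => (hy a i).2) hD2 J i).trans ?_
    calc 2 * (D : ℤ) ^ T * (24 * (n : ℤ) ^ (2 * c + 1))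
        ≤ 2 * (n : ℤ) ^ 6 * (24 * (n : ℤ) ^ (2 * c + 1)) := by gcongr
      _ ≤ 2 ^ 6 * ((n : ℤ) ^ 6 * (n : ℤ) ^ (2 * c + 1)) := by
        have : 0 ≤ (n : ℤ) ^ 6 * (n : ℤ) ^ (2 * c + 1) := by positivity
        linarith
      _ ≤ (n : ℤ) ^ 6 * ((n : ℤ) ^ 6 * (n : ℤ) ^ (2 * c + 1)) := by gcongr
      _ = (n : ℤ) ^ (2 * c + 13) := by ring
      _ ≤ (n : ℤ) ^ a := pow_le_pow_right₀ (by linarith) ha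
  have hmain := hsolve.mul_log_card_le (by linarith) (by simpa using by omega)
    (fun a i => (hy a i).1) hyk (by positivity) hsep hdiam hD hheight
  rw [Fintype.card_fin, ← hm'] at hmain
  have hlog2 : 0 < Real.log 2 := Real.log_pos (by norm_num)
  have hlogm : 0 ≤ Real.logb 2 m := Real.logb_nonneg (by norm_num) (by exact_mod_cast (by omega))
  have h1 : Real.logb 2 m * (Real.log n / Real.log K) ≤ Real.logb 2 m * (T + 1 : ℕ) :=
    mul_le_mul_of_nonneg_left hT1 hlogm
  have h2 : Real.logb 2 m * (T + 1 : ℕ) ≤ 8 * s := by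
    rw [Real.logb, div_mul_eq_mul_div, div_le_iff₀ hlog2]
    linarith
  rw [doublingDimension, ← hm]
  linarith
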